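/- Let $K$ be a field of characteristic different from $2$. A bicommutative superalgebra over $K$ is a (nonassociative) $\mathbb{Z}_2$-graded $K$-algebra $A=A_0\oplus A_1$, $A_iA_j\subseteq A_{i+j}$, in which all homogeneous elements satisfy $$x_1(x_2x_3)=(-1)^{\overline{x_1}\,\overline{x_2}}x_2(x_1x_3),\qquad (x_1x_2)x_3=(-1)^{\overline{x_2}\,\overline{x_3}}(x_1x_3)x_2,$$ where $\overline{x}\in\{0,1\}$ is the parity of $x$. Let $F(\mathfrak{B}_{\mathrm{sup}})$ be the free bicommutative superalgebra with even free generators $y_1,y_2,\ldots$ and odd free generators $z_1,z_2,\ldots$. For $p,q\ge 0$ with $p+q>0$ let $c_{p,q}(\mathfrak{B}_{\mathrm{sup}})$ be the dimension of the subspace $P_{p,q}$ of $F(\mathfrak{B}_{\mathrm{sup}})$ spanned by the products (with any arrangement of parentheses) in which each of $y_1,\ldots,y_p,z_1,\ldots,z_q$ occurs exactly once and no other generator occurs. For $n\ge 1$ let $c_n(\mathfrak{B}_{\mathrm{sup}})$ be the dimension of the subspace $P_n$ spanned by the products of degree $n$ in which, for each $i=1,\ldots,n$, exactly one of $y_i,z_i$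 occurs, and it occurs exactly once. Then $$c_{p,q}(\mathfrak{B}_{\mathrm{sup}})=\begin{cases}2^{p+q}-2,&\text{if }p+q>1,\\ 1,&\text{if }p+q=1,\end{cases}\qquad c_n(\mathfrak{B}_{\mathrm{sup}})=\begin{cases}2^{2n}-2^{n+1},&\text{if }n>1,\\ 2,&\text{if }n=1.\end{cases}$$ -/

import Mathlib

/-! ### Bicommutative superalgebras -/

/-- A (nonassociative, nonunital) `K`-algebra `A` together with a `ℤ/2`-grading `A = A₀ ⊕ A₁`
is a *bicommutative superalgebra* if `Aᵢ Aⱼ ⊆ Aᵢ₊ⱼ` and all homogeneous `a, b, c` satisfy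
`a (b c) = (-1)^{|a||b|} b (a c)` and `(a b) c = (-1)^{|b||c|} (a c) b`. -/
structure IsBicommutativeSuperalgebra (K : Type*) [Field K] {A : Type*}
    [NonUnitalNonAssocRing A] [Module K A] (𝒜 : ZMod 2 → Submodule K A) : Prop where
  isInternal : DirectSum.IsInternal 𝒜
  mul_mem : ∀ i j : ZMod 2, ∀ a ∈ 𝒜 i, ∀ b ∈ 𝒜 j, a * b ∈ 𝒜 (i + j)
  left_comm : ∀ i j k : ZMod 2, ∀ a ∈ 𝒜 i, ∀ b ∈ 𝒜 j, ∀ c ∈ 𝒜 k,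
    a * (b * c) = (-1 : K) ^ (i.val * j.val) • (b * (a * c))
  right_comm : ∀ i j k : ZMod 2, ∀ a ∈ 𝒜 i, ∀ b ∈ 𝒜 j, ∀ c ∈ 𝒜 k,
    (a * b) * c = (-1 : K) ^ (j.val * k.val) • ((a * c) * b)

/-! ### The free bicommutative superalgebra

Throughout, `Y` is the set of even generators, `Z` the set of odd generators, and the elements of
`FreeMagma (Y ⊕ Z)` are the nonassociative monomials in the generators. -/

namespace FreeBicomm

variable (K : Type*) [Field K] (Y Z : Type*)

/-- The free nonassociative `K`-algebra with generating set `Y ⊔ Z`. -/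
abbrev FreeAlg : Type _ := FreeNonUnitalNonAssocAlgebra K (Y ⊕ Z)

variable {Y Z} in
/-- The parity of a nonassociative monomial: the number of its odd letters modulo `2`. -/
def parity : FreeMagma (Y ⊕ Z) → ZMod 2
  | .of (.inl _) => 0
  | .of (.inr _) => 1
  | .mul u v => parity u + parity v

/-- The even (`i = 0`) and the odd (`i = 1`) component of the free nonassociative algebra. -/
noncomputable def freeComponent (i : ZMod 2) : Submodule K (FreeAlg K Y Z) :=
  Submodule.span K {f | ∃ w : FreeMagma (Y ⊕ Z), parity w = i ∧ f = MonoidAlgebra.single w 1}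

/-- The values of the super-identities of super-left- and super-right-commutativity on the
homogeneous elements of the free nonassociative algebra. -/
def superRelations : Set (FreeAlg K Y Z) :=
  {f | ∃ i j k : ZMod 2, ∃ a ∈ freeComponent K Y Z i, ∃ b ∈ freeComponent K Y Z j,
    ∃ c ∈ freeComponent K Y Z k,
      f = a * (b * c) - (-1 : K) ^ (i.val * j.val) • (b * (a * c)) ∨
      f = (a * b) * c - (-1 : K) ^ (j.val * k.val) • ((a * c) * b)}

/-- The two-sided ideal (as a `K`-subspace) generated by `superRelations`: the smallest subspace
that contains them and absorbs multiplication from both sides. -/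
noncomputable def relIdeal : Submodule K (FreeAlg K Y Z) :=
  sInf {I | superRelations K Y Z ⊆ I ∧ ∀ f ∈ I, ∀ g, g * f ∈ I ∧ f * g ∈ I}

theorem superRelations_subset : superRelations K Y Z ⊆ relIdeal K Y Z :=
  fun _ hf => (Submodule.mem_sInf).2 fun _ hI => hI.1 hf

variable {K Y Z} in
theorem mul_mem_relIdeal {f : FreeAlg K Y Z} (hf : f ∈ relIdeal K Y Z) (g : FreeAlg K Y Z) :
    g * f ∈ relIdeal K Y Z ∧ f * g ∈ relIdeal K Y Z :=
  ⟨(Submodule.mem_sInf).2 fun I hI => (hI.2 f ((Submodule.mem_sInf).1 hf I hI) g).1,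
   (Submodule.mem_sInf).2 fun I hI => (hI.2 f ((Submodule.mem_sInf).1 hf I hI) g).2⟩

end FreeBicomm

/-- The free bicommutative superalgebra over `K` on the set `Y` of even generators and the set `Z`
of odd generators. -/
def FreeBicommSuper (K : Type*) [Field K] (Y Z : Type*) : Type _ :=
  FreeBicomm.FreeAlg K Y Z ⧸ FreeBicomm.relIdeal K Y Z

namespace FreeBicommSuper

open FreeBicomm

variable (K : Type*) [Field K] (Y Z : Type*)

noncomputable instance instAddCommGroup : AddCommGroup (FreeBicommSuper K Y Z) :=
  inferInstanceAs (AddCommGroup (FreeAlg K Y Z ⧸ relIdeal K Y Z))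

noncomputable instance instModule : Module K (FreeBicommSuper K Y Z) :=
  inferInstanceAs (Module K (FreeAlg K Y Z ⧸ relIdeal K Y Z))

/-- The canonical projection from the free nonassociative algebra. -/
noncomputable def proj : FreeAlg K Y Z →ₗ[K] FreeBicommSuper K Y Z :=
  (relIdeal K Y Z).mkQ

theorem proj_surjective : Function.Surjective (proj K Y Z) :=
  (relIdeal K Y Z).mkQ_surjective

variable {K Y Z} in
theorem proj_eq_iff {f g : FreeAlg K Y Z} :
    proj K Y Z f = proj K Y Z g ↔ f - g ∈ relIdeal K Y Z :=
  Submodule.Quotient.eq (relIdeal K Y Z)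

/-- The multiplication induced by that of the free nonassociative algebra. -/
noncomputable instance instMul : Mul (FreeBicommSuper K Y Z) where
  mul := Quotient.map₂ (fun f g : FreeAlg K Y Z => f * g) (by
    intro f f' hf g g' hg
    have hf' : f - f' ∈ relIdeal K Y Z := (Submodule.quotientRel_def _).1 hf
    have hg' : g - g' ∈ relIdeal K Y Z := (Submodule.quotientRel_def _).1 hg
    refine (Submodule.quotientRel_def _).2 ?_
    have h : f * g - f' * g' = f * (g - g') + (f - f') * g' := by
      rw [mul_sub, sub_mul]; abel
    rw [h]
    exact add_mem (mul_mem_relIdeal hg' f).1 (mul_mem_relIdeal hf' g').2)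

theorem proj_mul (f g : FreeAlg K Y Z) :
    proj K Y Z (f * g) = proj K Y Z f * proj K Y Z g := rfl

noncomputable instance instRing : NonUnitalNonAssocRing (FreeBicommSuper K Y Z) where
  __ := instAddCommGroup K Y Z
  __ := instMul K Y Z
  left_distrib a b c := by
    obtain ⟨a, rfl⟩ := proj_surjective K Y Z a
    obtain ⟨b, rfl⟩ := proj_surjective K Y Z b
    obtain ⟨c, rfl⟩ := proj_surjective K Y Z c
    simp only [← map_add, ← proj_mul, mul_add]
  right_distrib a b c := by
    obtain ⟨a, rfl⟩ := proj_surjective K Y Z a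
    obtain ⟨b, rfl⟩ := proj_surjective K Y Z b
    obtain ⟨c, rfl⟩ := proj_surjective K Y Z c
    simp only [← map_add, ← proj_mul, add_mul]
  zero_mul a := by
    obtain ⟨a, rfl⟩ := proj_surjective K Y Z a
    rw [← map_zero (proj K Y Z), ← proj_mul, zero_mul]
  mul_zero a := by
    obtain ⟨a, rfl⟩ := proj_surjective K Y Z a
    rw [← map_zero (proj K Y Z), ← proj_mul, mul_zero]

instance instIsScalarTower :
    IsScalarTower K (FreeBicommSuper K Y Z) (FreeBicommSuper K Y Z) where
  smul_assoc r a b := by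
    obtain ⟨a, rfl⟩ := proj_surjective K Y Z a
    obtain ⟨b, rfl⟩ := proj_surjective K Y Z b
    simp only [smul_eq_mul, ← map_smul, ← proj_mul, smul_mul_assoc]

instance instSMulCommClass :
    SMulCommClass K (FreeBicommSuper K Y Z) (FreeBicommSuper K Y Z) where
  smul_comm r a b := by
    obtain ⟨a, rfl⟩ := proj_surjective K Y Z a
    obtain ⟨b, rfl⟩ := proj_surjective K Y Z b
    simp only [smul_eq_mul, ← map_smul, ← proj_mul, mul_smul_comm]

variable {Y Z} in
/-- The class of a generator: `of (inl y)` is even, `of (inr z)` is odd. -/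
noncomputable def of (x : Y ⊕ Z) : FreeBicommSuper K Y Z :=
  proj K Y Z (FreeNonUnitalNonAssocAlgebra.of K x)

/-- The even (`i = 0`) and the odd (`i = 1`) component of the free bicommutative superalgebra. -/
noncomputable def component (i : ZMod 2) : Submodule K (FreeBicommSuper K Y Z) :=
  (freeComponent K Y Z i).map (proj K Y Z)

end FreeBicommSuper

/-! ### It is the free object of the variety of bicommutative superalgebras -/
namespace FreeBicommSuper
open FreeBicomm

section grading
variable {K : Type*} [Field K] {Y Z : Type*}

theorem single_mem_freeComponent (w : FreeMagma (Y ⊕ Z)) (r : K) :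
    (MonoidAlgebra.single w r : FreeAlg K Y Z) ∈ freeComponent K Y Z (parity w) := by
  have h : (MonoidAlgebra.single w r : FreeAlg K Y Z) = r • MonoidAlgebra.single w 1 := by simp
  rw [h]
  exact Submodule.smul_mem _ _ (Submodule.subset_span ⟨w, rfl, rfl⟩)

theorem free_mul_mem {i j : ZMod 2} {a b : FreeAlg K Y Z} (ha : a ∈ freeComponent K Y Z i)
    (hb : b ∈ freeComponent K Y Z j) : a * b ∈ freeComponent K Y Z (i + j) := by
  induction ha using Submodule.span_induction with
  | zero => simp
  | add x y _ _ hx hy => rw [add_mul]; exact add_mem hx hy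
  | smul r x _ hx => rw [smul_mul_assoc]; exact Submodule.smul_mem _ _ hx
  | mem x hx =>
    obtain ⟨u, rfl, rfl⟩ := hx
    induction hb using Submodule.span_induction with
    | zero => simp
    | add x y _ _ hx hy => rw [mul_add]; exact add_mem hx hy
    | smul r x _ hx => rw [mul_smul_comm]; exact Submodule.smul_mem _ _ hx
    | mem x hx =>
      obtain ⟨v, rfl, rfl⟩ := hx
      rw [MonoidAlgebra.single_mul_single]
      exact single_mem_freeComponent (u * v) _

open scoped Classical in
/-- The projection of the free nonassociative algebra to its component of parity `i`. -/
noncomputable def part (i : ZMod 2) : FreeAlg K Y Z →ₗ[K] FreeAlg K Y Z :=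
  (Finsupp.lsum K fun w => if parity w = i then
      (LinearMap.toSpanSingleton K (FreeAlg K Y Z) (MonoidAlgebra.single w 1)) else 0) ∘ₗ
    (MonoidAlgebra.coeffLinearEquiv K).toLinearMap

theorem part_single (i : ZMod 2) (w : FreeMagma (Y ⊕ Z)) (r : K) :
    part i (MonoidAlgebra.single w r : FreeAlg K Y Z) =
      if parity w = i then MonoidAlgebra.single w r else 0 := by
  classical
  simp [part]
  split_ifs <;> simp

theorem part_of_mem {i j : ZMod 2} {a : FreeAlg K Y Z} (ha : a ∈ freeComponent K Y Z j) :
    part i a = if j = i then a else 0 := by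
  induction ha using Submodule.span_induction with
  | zero => simp
  | add x y _ _ hx hy => rw [map_add, hx, hy]; split_ifs <;> simp
  | smul r x _ hx => rw [map_smul, hx]; split_ifs <;> simp
  | mem x hx => obtain ⟨u, rfl, rfl⟩ := hx; exact part_single _ _ _

theorem exists_decomp (a : FreeAlg K Y Z) :
    ∃ b ∈ freeComponent K Y Z 0, ∃ c ∈ freeComponent K Y Z 1, a = b + c := by
  have h : a ∈ freeComponent K Y Z 0 ⊔ freeComponent K Y Z 1 := by
    have hs : a ∈ Submodule.span K (Set.range fun w : FreeMagma (Y ⊕ Z) =>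
        (MonoidAlgebra.single w 1 : FreeAlg K Y Z)) := by
      induction a using MonoidAlgebra.induction_linear with
      | zero => simp
      | add f g hf hg => exact add_mem hf hg
      | single w r =>
        have h : (MonoidAlgebra.single w r : FreeAlg K Y Z) = r • MonoidAlgebra.single w 1 := by
          simp
        rw [h]
        exact Submodule.smul_mem _ _ (Submodule.subset_span ⟨w, rfl⟩)
    refine (Submodule.span_le.2 ?_) hs
    rintro _ ⟨w, rfl⟩
    have hw := single_mem_freeComponent w (1 : K)
    have : parity w = 0 ∨ parity w = 1 := by
      generalize parity w = t; revert t; decide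
    rcases this with h | h <;> rw [h] at hw
    · exact Submodule.mem_sup_left hw
    · exact Submodule.mem_sup_right hw
  obtain ⟨b, hb, c, hc, h⟩ := Submodule.mem_sup.1 h
  exact ⟨b, hb, c, hc, h.symm⟩

theorem part_mem_relIdeal (l : ZMod 2) {f : FreeAlg K Y Z} (hf : f ∈ relIdeal K Y Z) :
    part l f ∈ relIdeal K Y Z := by
  have key : relIdeal K Y Z ≤ relIdeal K Y Z ⊓ ⨅ l, (relIdeal K Y Z).comap (part l) := by
    refine sInf_le ⟨?_, ?_⟩
    · intro f hf
      refine ⟨superRelations_subset K Y Z hf, ?_⟩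
      simp only [SetLike.mem_coe, Submodule.mem_iInf, Submodule.mem_comap]
      intro l
      have hf' := superRelations_subset K Y Z hf
      obtain ⟨i, j, k, a, ha, b, hb, c, hc, h⟩ := hf
      have hd : f ∈ freeComponent K Y Z (i + (j + k)) := by
        rcases h with rfl | rfl
        · refine sub_mem (free_mul_mem ha (free_mul_mem hb hc)) (Submodule.smul_mem _ _ ?_)
          rw [show i + (j + k) = j + (i + k) by ring]
          exact free_mul_mem hb (free_mul_mem ha hc)
        · rw [← add_assoc]
          refine sub_mem (free_mul_mem (free_mul_mem ha hb) hc) (Submodule.smul_mem _ _ ?_)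
          rw [show i + j + k = i + k + j by ring]
          exact free_mul_mem (free_mul_mem ha hc) hb
      rw [part_of_mem hd]
      split_ifs
      · exact hf'
      · exact zero_mem _
    · rintro f ⟨hf, hf2⟩ g
      simp only [SetLike.mem_coe, Submodule.mem_iInf, Submodule.mem_comap] at hf2
      refine ⟨⟨(mul_mem_relIdeal hf g).1, ?_⟩, ⟨(mul_mem_relIdeal hf g).2, ?_⟩⟩ <;>
      · simp only [SetLike.mem_coe, Submodule.mem_iInf, Submodule.mem_comap]
        intro l
        obtain ⟨b, hb, c, hc, hbc⟩ := exists_decomp f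
        obtain ⟨b', hb', c', hc', rfl⟩ := exists_decomp g
        have h0 := hf2 0
        have h1 := hf2 1
        rw [hbc, map_add, part_of_mem hb, part_of_mem hc] at h0 h1
        simp only [reduceIte, one_ne_zero, zero_ne_one, add_zero, zero_add] at h0 h1
        rw [hbc]
        simp only [mul_add, add_mul, map_add, part_of_mem (free_mul_mem hb hb'),
          part_of_mem (free_mul_mem hb hc'), part_of_mem (free_mul_mem hc hb'),
          part_of_mem (free_mul_mem hc hc'), part_of_mem (free_mul_mem hb' hb),
          part_of_mem (free_mul_mem hb' hc), part_of_mem (free_mul_mem hc' hb),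
          part_of_mem (free_mul_mem hc' hc)]
        have e1 := mul_mem_relIdeal h0 b'
        have e2 := mul_mem_relIdeal h0 c'
        have e3 := mul_mem_relIdeal h1 b'
        have e4 := mul_mem_relIdeal h1 c'
        refine add_mem (add_mem ?_ ?_) (add_mem ?_ ?_) <;>
        · split_ifs
          · first | exact e1.1 | exact e2.1 | exact e3.1 | exact e4.1
                  | exact e1.2 | exact e2.2 | exact e3.2 | exact e4.2
          · exact zero_mem _
  have := (key hf).2
  simp only [SetLike.mem_coe, Submodule.mem_iInf, Submodule.mem_comap] at this
  exact this l

variable (K Y Z) in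
/-- The free bicommutative superalgebra is a bicommutative superalgebra. -/
theorem isBicommutativeSuperalgebra :
    IsBicommutativeSuperalgebra K (component K Y Z) where
  isInternal := by
    rw [DirectSum.isInternal_submodule_iff_isCompl (component K Y Z) (i := 0) (j := 1)
      (by decide) (by ext t; revert t; decide)]
    constructor
    · rw [Submodule.disjoint_def]
      rintro x ⟨a, ha, rfl⟩ ⟨b, hb, hab⟩
      have h := part_mem_relIdeal 0 (proj_eq_iff.1 hab)
      rw [map_sub, part_of_mem hb, part_of_mem ha] at h
      simp only [one_ne_zero, reduceIte, zero_sub, neg_mem_iff] at h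
      rw [← map_zero (proj K Y Z), proj_eq_iff, sub_zero]
      exact h
    · rw [codisjoint_iff, eq_top_iff]
      rintro x -
      obtain ⟨a, rfl⟩ := proj_surjective K Y Z x
      obtain ⟨b, hb, c, hc, rfl⟩ := exists_decomp a
      rw [map_add]
      exact Submodule.add_mem_sup ⟨b, hb, rfl⟩ ⟨c, hc, rfl⟩
  mul_mem := by
    rintro i j _ ⟨a, ha, rfl⟩ _ ⟨b, hb, rfl⟩
    exact ⟨a * b, free_mul_mem ha hb, rfl⟩
  left_comm := by
    rintro i j k _ ⟨a, ha, rfl⟩ _ ⟨b, hb, rfl⟩ _ ⟨c, hc, rfl⟩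
    simp only [← proj_mul, ← map_smul]
    exact proj_eq_iff.2 (superRelations_subset K Y Z ⟨i, j, k, a, ha, b, hb, c, hc, Or.inl rfl⟩)
  right_comm := by
    rintro i j k _ ⟨a, ha, rfl⟩ _ ⟨b, hb, rfl⟩ _ ⟨c, hc, rfl⟩
    simp only [← proj_mul, ← map_smul]
    exact proj_eq_iff.2 (superRelations_subset K Y Z ⟨i, j, k, a, ha, b, hb, c, hc, Or.inr rfl⟩)

/-- The universal property: every parity-preserving map of the generators to a bicommutative
superalgebra extends uniquely to a homomorphism of algebras (which preserves the parity). -/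
theorem existsUnique_lift {A : Type*} [NonUnitalNonAssocRing A] [Module K A]
    [IsScalarTower K A A] [SMulCommClass K A A] {𝒜 : ZMod 2 → Submodule K A}
    (hA : IsBicommutativeSuperalgebra K 𝒜) (f : Y ⊕ Z → A)
    (hY : ∀ y, f (.inl y) ∈ 𝒜 0) (hZ : ∀ z, f (.inr z) ∈ 𝒜 1) :
    (∃! φ : FreeBicommSuper K Y Z →ₙₐ[K] A, ∀ x, φ (of K x) = f x) ∧
    ∀ φ : FreeBicommSuper K Y Z →ₙₐ[K] A, (∀ x, φ (of K x) = f x) →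
      ∀ i, ∀ a ∈ component K Y Z i, φ a ∈ 𝒜 i := by
  have hgr : ∀ i, ∀ a ∈ freeComponent K Y Z i,
      FreeNonUnitalNonAssocAlgebra.lift K f a ∈ 𝒜 i := by
    intro i a ha
    induction ha using Submodule.span_induction with
    | zero => simp
    | add x y _ _ hx hy => rw [map_add]; exact add_mem hx hy
    | smul r x _ hx => rw [map_smul]; exact Submodule.smul_mem _ _ hx
    | mem x hx =>
      obtain ⟨u, rfl, rfl⟩ := hx
      induction u using FreeMagma.recOnMul with
      | ih1 x =>
        have h := FreeNonUnitalNonAssocAlgebra.lift_of_apply K f x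
        have h' : (MonoidAlgebra.single (FreeMagma.of x) 1 : FreeAlg K Y Z) =
          FreeNonUnitalNonAssocAlgebra.of K x := rfl
        rw [h', h]
        rcases x with y | z
        · exact hY y
        · exact hZ z
      | ih2 u v hu hv =>
        have h' : (MonoidAlgebra.single (u * v) 1 : FreeAlg K Y Z) =
          MonoidAlgebra.single u 1 * MonoidAlgebra.single v 1 := by
            rw [MonoidAlgebra.single_mul_single, one_mul]
        rw [h', map_mul]
        exact hA.mul_mem _ _ _ hu _ hv
  have hker : relIdeal K Y Z ≤
      LinearMap.ker (FreeNonUnitalNonAssocAlgebra.lift K f : FreeAlg K Y Z →ₗ[K] A) := by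
    refine sInf_le ⟨?_, ?_⟩
    · rintro x ⟨i, j, k, a, ha, b, hb, c, hc, rfl | rfl⟩
      · simp [hA.left_comm i j k _ (hgr _ a ha) _ (hgr _ b hb) _ (hgr _ c hc)]
      · simp [hA.right_comm i j k _ (hgr _ a ha) _ (hgr _ b hb) _ (hgr _ c hc)]
    · intro a ha g
      have ha' : FreeNonUnitalNonAssocAlgebra.lift K f a = 0 := ha
      constructor <;> simp [ha']
  have hcomp : ∀ φ : FreeBicommSuper K Y Z →ₙₐ[K] A, (∀ x, φ (of K x) = f x) →
      ∀ a, φ (proj K Y Z a) = FreeNonUnitalNonAssocAlgebra.lift K f a := by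
    intro φ hφ a
    let ψ : FreeAlg K Y Z →ₙₐ[K] A :=
      φ.comp { proj K Y Z with map_mul' := proj_mul K Y Z, map_zero' := map_zero (proj K Y Z) }
    have : ψ = FreeNonUnitalNonAssocAlgebra.lift K f :=
      (FreeNonUnitalNonAssocAlgebra.lift_unique K f ψ).1 (funext hφ)
    exact DFunLike.congr_fun this a
  let φ₀ : FreeBicommSuper K Y Z →ₗ[K] A := (relIdeal K Y Z).liftQ _ hker
  have h₀ : ∀ a, φ₀ (proj K Y Z a) = FreeNonUnitalNonAssocAlgebra.lift K f a := fun a => rfl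
  refine ⟨⟨{ φ₀ with map_mul' := ?_, map_zero' := map_zero φ₀ }, ?_, ?_⟩, ?_⟩
  · intro a b
    obtain ⟨a, rfl⟩ := proj_surjective K Y Z a
    obtain ⟨b, rfl⟩ := proj_surjective K Y Z b
    change φ₀ _ = φ₀ _ * φ₀ _
    rw [← proj_mul, h₀, h₀, h₀, map_mul]
  · intro x
    exact FreeNonUnitalNonAssocAlgebra.lift_of_apply K f x
  · intro φ hφ
    ext a
    obtain ⟨a, rfl⟩ := proj_surjective K Y Z a
    exact (hcomp φ hφ a).trans (h₀ a).symm
  · rintro φ hφ i _ ⟨a, ha, rfl⟩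
    rw [hcomp φ hφ]
    exact hgr i a ha

end grading
end FreeBicommSuper

/-! ### Multilinear components and codimensions

The free generators are `y₀, y₁, …` (even) and `z₀, z₁, …` (odd), that is, `Y = Z = ℕ`. -/

namespace FreeBicommSuper

open FreeBicomm

/-- The letters of a nonassociative monomial, with multiplicities. -/
def letters {X : Type*} : FreeMagma X → Multiset X
  | .of x => {x}
  | .mul u v => letters u + letters v

/-- The element of the free bicommutative superalgebra that a nonassociative monomial stands for. -/
noncomputable def monomial (K : Type*) [Field K] {Y Z : Type*} (w : FreeMagma (Y ⊕ Z)) :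
    FreeBicommSuper K Y Z :=
  FreeMagma.lift (of K) w

/-- The multilinear component `P_{p,q}` in the even variables `y₀, …, y_{p-1}` and the odd
variables `z₀, …, z_{q-1}`: the span of the monomials in which each of these variables occurs
exactly once, and no other variable occurs. -/
noncomputable def superMultilinear (K : Type*) [Field K] (p q : ℕ) :
    Submodule K (FreeBicommSuper K ℕ ℕ) :=
  Submodule.span K {f | ∃ w : FreeMagma (ℕ ⊕ ℕ),
    letters w = (Multiset.range p).map Sum.inl + (Multiset.range q).map Sum.inr ∧
    f = monomial K w}

/-- The multilinear component `P_n` in `x₀, …, x_{n-1}`, where each `x_i` is `y_i` or `z_i`: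
the span of the monomials in which, for each `i < n`, exactly one of `y_i`, `z_i` occurs, exactly
once, and no other variable occurs. -/
noncomputable def multilinear (K : Type*) [Field K] (n : ℕ) :
    Submodule K (FreeBicommSuper K ℕ ℕ) :=
  Submodule.span K {f | ∃ w : FreeMagma (ℕ ⊕ ℕ),
    (letters w).map (Sum.elim id id) = Multiset.range n ∧ f = monomial K w}

/-- The super-codimension `c_{p,q} = dim P_{p,q}`. -/
noncomputable def superCodim (K : Type*) [Field K] (p q : ℕ) : Cardinal :=
  Module.rank K (superMultilinear K p q)

/-- The ordinary codimension `c_n = dim P_n`. -/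
noncomputable def codim (K : Type*) [Field K] (n : ℕ) : Cardinal :=
  Module.rank K (multilinear K n)

end FreeBicommSuper

/-!
In a multilinear monomial, label each letter as a left or a right leaf, according to the side on
which it enters the innermost product that contains it. Both identities only permute left leaves
among themselves or right leaves among themselves, up to the sign of the permutation of the odd
letters. A product has leaves of both kinds, so a set of `n > 1` letters admits `2 ^ n - 2`
labellings, and these labellings index a basis of the multilinear component.

*Spanning.* Identify monomials that agree up to sign in the free superalgebra. The quotient is a
magma with `a (b c) = b (a c)` and `(a b) c = (a c) b`. On its products all left and right
multiplications commute, and multiplication by `a b` from either side is left multiplication by `a`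
followed by right multiplication by `b`. So a monomial acts on products through its leaf labels, and
its value depends only on these labels (`IsBicommutativeMagma.lift_eq_of_leafLabels_eq`,
`FreeBicommSuper.monomial_eq_or_neg`).

*Independence.* Let `P` be a supercommutative associative algebra. Then `P × P` with the product
`(a₁, a₂) (b₁, b₂) = (a₁ b₂, a₁ b₂)` is a bicommutative superalgebra: the two components of an
element are its values as a left and as a right factor. Take for `P` the square-free part of the
free supercommutative algebra, with basis elements `e_U` for finite sets `U` of letters. For a set
`S` of letters, send `x` to `(e_x, 0)` if `x ∈ S` and to `(0, e_x)` otherwise. This homomorphism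
kills every multilinear monomial, except that those whose set of left leaves consists of their
letters in `S` go to `± e_U`, where `U` is the set of their letters
(`FreeBicommSuper.exists_toModel_monomial`). The coefficients at `e_U` are, up to sign, dual to the
monomials indexed by the labellings, and `FreeBicommSuper.rank_span_monomial` follows. Both
codimensions are special cases: for `c_{p,q}` there is one set of letters, and for `c_n` there are
`2 ^ n` of them.
-/

/-! ### Leaf labels -/

namespace FreeMagma

variable {X : Type*}

/-- The leaves of a nonassociative monomial, each with the label `true` if it is the left factor
and `false` if it is the right factor of the product it takes part in. The flag `b` is the label of
the monomial itself, and matters only if the monomial is a single letter. -/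
def leafLabels : Bool → FreeMagma X → Multiset (X × Bool)
  | b, .of x => {(x, b)}
  | _, .mul u v => leafLabels true u + leafLabels false v

@[simp] theorem leafLabels_of (b : Bool) (x : X) : leafLabels b (of x) = {(x, b)} := rfl

@[simp] theorem leafLabels_mul (b : Bool) (u v : FreeMagma X) :
    leafLabels b (u * v) = leafLabels true u + leafLabels false v := rfl

theorem exists_mem_leafLabels (b : Bool) (w : FreeMagma X) : ∃ x, (x, b) ∈ leafLabels b w := by
  induction w using FreeMagma.recOnMul generalizing b with
  | ih1 x => exact ⟨x, by simp⟩
  | ih2 u v hu hv =>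
    cases b
    · obtain ⟨x, hx⟩ := hv false
      exact ⟨x, by simp [hx]⟩
    · obtain ⟨x, hx⟩ := hu true
      exact ⟨x, by simp [hx]⟩

theorem card_leafLabels_pos (b : Bool) (w : FreeMagma X) : 0 < (leafLabels b w).card := by
  obtain ⟨x, hx⟩ := exists_mem_leafLabels b w
  exact Multiset.card_pos_iff_exists_mem.2 ⟨_, hx⟩

/-- Every multiset of labelled letters with at least one left and one right letter consists of the
leaf labels of a product. -/
theorem exists_leafLabels_eq (x y : X) (m : Multiset (X × Bool)) :
    ∃ u v : FreeMagma X, leafLabels true (u * v) = (x, true) ::ₘ (y, false) ::ₘ m := by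
  induction m using Multiset.induction_on with
  | empty => exact ⟨of x, of y, rfl⟩
  | cons p m ih =>
    obtain ⟨u, v, h⟩ := ih
    rw [leafLabels_mul] at h
    obtain ⟨z, b⟩ := p
    cases b
    · refine ⟨u * v, of z, ?_⟩
      rw [leafLabels_mul, leafLabels_mul, h, leafLabels_of, ← Multiset.singleton_add (z, false),
        ← Multiset.singleton_add (x, true), ← Multiset.singleton_add (y, false),
        ← Multiset.singleton_add (x, true), ← Multiset.singleton_add (y, false)]
      abel
    · refine ⟨of z, u * v, ?_⟩
      rw [leafLabels_mul, leafLabels_mul, h, leafLabels_of, ← Multiset.singleton_add (z, true),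
        ← Multiset.singleton_add (x, true), ← Multiset.singleton_add (y, false),
        ← Multiset.singleton_add (x, true), ← Multiset.singleton_add (y, false)]
      abel

end FreeMagma

/-! ### Bicommutative magmas -/

/-- A magma is bicommutative if `a (b c) = b (a c)` and `(a b) c = (a c) b`. -/
class IsBicommutativeMagma (C : Type*) [Mul C] : Prop where
  left_comm : ∀ a b c : C, a * (b * c) = b * (a * c)
  right_comm : ∀ a b c : C, (a * b) * c = (a * c) * b

namespace IsBicommutativeMagma

variable {C : Type*} [Mul C] [IsBicommutativeMagma C]

/-- Left and right multiplications commute on products. -/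
theorem left_right_comm (u v a b : C) : u * ((a * b) * v) = (u * (a * b)) * v := by
  rw [right_comm a b v, left_comm u (a * v) b, left_comm u a b, right_comm a (u * b) v]

/-- On products, left multiplication by `a b` is left multiplication by `a` followed by right
multiplication by `b`. -/
theorem mul_mul_mul_eq (a b c d : C) : (a * b) * (c * d) = (a * (c * d)) * b := by
  rw [left_comm (a * b) c d, right_comm a b d, left_right_comm, left_comm]

/-- On products, right multiplication by `a b` is left multiplication by `a` followed by right
multiplication by `b`. -/
theorem mul_mul_mul_eq' (a b c d : C) : (c * d) * (a * b) = (a * (c * d)) * b := by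
  rw [mul_mul_mul_eq, left_comm c a b, ← left_right_comm, right_comm c b d, left_right_comm]

variable (C) in
/-- The products in a magma. -/
abbrev Products : Type _ := {c : C // ∃ a b : C, c = a * b}

variable {X : Type*} (f : X → C)

/-- The action of labelled letters on products: left multiplication for the label `true`, right
multiplication for the label `false`. -/
def act (p : X × Bool) (c : Products C) : Products C :=
  if p.2 then ⟨f p.1 * c.1, _, _, rfl⟩ else ⟨c.1 * f p.1, _, _, rfl⟩

instance : LeftCommutative (act f) where
  left_comm := by
    rintro ⟨x, i⟩ ⟨y, j⟩ ⟨_, a, b, rfl⟩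
    apply Subtype.ext
    cases i <;> cases j
    · exact right_comm _ _ _
    · exact (left_right_comm _ _ _ _).symm
    · exact left_right_comm _ _ _ _
    · exact left_comm _ _ _

theorem act_foldr (p : X × Bool) (c : Products C) (m : Multiset (X × Bool)) :
    act f p (m.foldr (act f) c) = m.foldr (act f) (act f p c) := by
  induction m using Multiset.induction_on with
  | empty => rfl
  | cons q m ih => rw [Multiset.foldr_cons, Multiset.foldr_cons, ← ih,
      LeftCommutative.left_comm (op := act f)]

/-- A monomial acts on products, from either side, through its leaf labels. -/
theorem lift_mul_eq_foldr (w : FreeMagma X) (c : Products C) :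
    FreeMagma.lift f w * c.1 = ((w.leafLabels true).foldr (act f) c).1 ∧
    c.1 * FreeMagma.lift f w = ((w.leafLabels false).foldr (act f) c).1 := by
  induction w using FreeMagma.recOnMul generalizing c with
  | ih1 x => exact ⟨rfl, rfl⟩
  | ih2 u v hu hv =>
    have key : FreeMagma.lift f u * c.1 * FreeMagma.lift f v =
        ((v.leafLabels false + u.leafLabels true).foldr (act f) c).1 := by
      rw [Multiset.foldr_add, (hu c).1, (hv _).2]
    obtain ⟨_, a, b, rfl⟩ := c
    rw [map_mul, FreeMagma.leafLabels_mul, FreeMagma.leafLabels_mul, mul_mul_mul_eq,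
      mul_mul_mul_eq', add_comm]
    exact ⟨key, key⟩

/-- Every product of monomials arises from a product of two letters by the action of the remaining
labelled letters. -/
theorem exists_lift_eq_foldr (u v : FreeMagma X) : ∃ x y m,
    (u * v).leafLabels true = (x, true) ::ₘ (y, false) ::ₘ m ∧
    FreeMagma.lift f (u * v) = (m.foldr (act f) ⟨f x * f y, _, _, rfl⟩).1 := by
  have key : ∀ w : FreeMagma X, (∃ x, w = .of x) ∨ ∃ x y m,
      w.leafLabels true = (x, true) ::ₘ (y, false) ::ₘ m ∧ w.leafLabels false =
        w.leafLabels true ∧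
      FreeMagma.lift f w = (m.foldr (act f) ⟨f x * f y, _, _, rfl⟩).1 := by
    intro w
    induction w using FreeMagma.recOnMul with
    | ih1 x => exact .inl ⟨x, rfl⟩
    | ih2 u v hu hv =>
      refine .inr ?_
      rcases hv with ⟨y, rfl⟩ | ⟨x, y, m, h, h', e⟩
      · rcases hu with ⟨x, rfl⟩ | ⟨x, z, m, h, h', e⟩
        · exact ⟨x, y, 0, rfl, rfl, rfl⟩
        · refine ⟨x, z, (y, false) ::ₘ m, ?_, rfl, ?_⟩
          · rw [FreeMagma.leafLabels_mul, h, FreeMagma.leafLabels_of, add_comm,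
              Multiset.singleton_add, Multiset.cons_swap, Multiset.cons_swap (y, false) (z, false)]
          · rw [map_mul, e, Multiset.foldr_cons]
            rfl
      · refine ⟨x, y, u.leafLabels true + m, ?_, rfl, ?_⟩
        · rw [FreeMagma.leafLabels_mul, h', h, Multiset.add_cons, Multiset.add_cons]
        · rw [map_mul, e, Multiset.foldr_add, (lift_mul_eq_foldr f u _).1]
  rcases key (u * v) with ⟨x, h⟩ | ⟨x, y, m, h, -, e⟩
  · cases h
  · exact ⟨x, y, m, h, e⟩

theorem foldr_eq_of_cons_right_eq (x : X) {y y' : X} {m m' : Multiset (X × Bool)}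
    (h : (y, false) ::ₘ m = (y', false) ::ₘ m') :
    m.foldr (act f) ⟨f x * f y, _, _, rfl⟩ = m'.foldr (act f) ⟨f x * f y', _, _, rfl⟩ := by
  rcases Multiset.cons_eq_cons.1 h with ⟨h1, rfl⟩ | ⟨-, k, rfl, rfl⟩
  · cases h1; rfl
  · rw [Multiset.foldr_cons, Multiset.foldr_cons, act_foldr, act_foldr]
    congr 1
    exact Subtype.ext (right_comm _ _ _)

/-- The value of the letters of a product does not depend on the choice of the left and the right
letter that are multiplied first. -/
theorem foldr_eq_of_cons_cons_eq {x x' y y' : X} {m m' : Multiset (X × Bool)}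
    (h : (x, true) ::ₘ (y, false) ::ₘ m = (x', true) ::ₘ (y', false) ::ₘ m') :
    m.foldr (act f) ⟨f x * f y, _, _, rfl⟩ = m'.foldr (act f) ⟨f x' * f y', _, _, rfl⟩ := by
  rcases Multiset.cons_eq_cons.1 h with ⟨h1, h2⟩ | ⟨-, k, h1, h2⟩
  · cases h1
    exact foldr_eq_of_cons_right_eq f x h2
  · rcases Multiset.cons_eq_cons.1 h1 with ⟨h3, -⟩ | ⟨-, l, rfl, h3⟩
    · cases h3
    rcases Multiset.cons_eq_cons.1 h2 with ⟨h4, -⟩ | ⟨-, l', rfl, h4⟩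
    · cases h4
    have e : ((x, true) ::ₘ l').foldr (act f) ⟨f x' * f y', _, _, rfl⟩ =
        ((x', true) ::ₘ l').foldr (act f) ⟨f x * f y', _, _, rfl⟩ := by
      rw [Multiset.foldr_cons, Multiset.foldr_cons, act_foldr, act_foldr]
      congr 1
      exact Subtype.ext (left_comm _ _ _)
    rw [e]
    apply foldr_eq_of_cons_right_eq
    rw [Multiset.cons_swap, ← h3, h4, Multiset.cons_swap]

/-- In a bicommutative magma the value of a monomial depends only on its leaf labels. -/
theorem lift_eq_of_leafLabels_eq {w w' : FreeMagma X}
    (h : w.leafLabels true = w'.leafLabels true) :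
    FreeMagma.lift f w = FreeMagma.lift f w' := by
  have hcard : ∀ (x : X) (u v : FreeMagma X),
      (FreeMagma.of x).leafLabels true ≠ (u * v).leafLabels true := by
    intro x u v h
    have := congrArg Multiset.card h
    have hu := u.card_leafLabels_pos true
    have hv := v.card_leafLabels_pos false
    simp at this
    omega
  induction w using FreeMagma.recOnMul with
  | ih1 x =>
    induction w' using FreeMagma.recOnMul with
    | ih1 y =>
      have : x = y := by simpa using h
      rw [this]
    | ih2 u v => exact absurd h (hcard x u v)
  | ih2 u v =>
    induction w' using FreeMagma.recOnMul with
    | ih1 y => exact absurd h.symm (hcard y u v)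
    | ih2 u' v' =>
      obtain ⟨x, y, m, h1, e1⟩ := exists_lift_eq_foldr f u v
      obtain ⟨x', y', m', h2, e2⟩ := exists_lift_eq_foldr f u' v'
      rw [e1, e2, foldr_eq_of_cons_cons_eq f (h1.symm.trans (h.trans h2))]

end IsBicommutativeMagma

/-! ### A family of model superalgebras -/

/-- The sign `(-1)^{ij}` of the transposition of homogeneous elements of parities `i`, `j`. -/
def koszulSign (K : Type*) [Field K] (i j : ZMod 2) : K := (-1) ^ (i.val * j.val)

section koszulSign
variable {K : Type*} [Field K]

theorem koszulSign_add_left (i j k : ZMod 2) :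
    koszulSign K (i + j) k = koszulSign K i k * koszulSign K j k := by
  have h : ∀ i j k : ZMod 2, ((i + j).val * k.val) % 2 = (i.val * k.val + j.val * k.val) % 2 := by
    decide
  rw [koszulSign, koszulSign, koszulSign, ← pow_add, neg_one_pow_eq_pow_mod_two, h,
    ← neg_one_pow_eq_pow_mod_two]

theorem koszulSign_comm (i j : ZMod 2) : koszulSign K i j = koszulSign K j i := by
  rw [koszulSign, koszulSign, mul_comm]

theorem koszulSign_zero_left (j : ZMod 2) : koszulSign K 0 j = 1 := by simp [koszulSign]

theorem koszulSign_sum_left {X : Type*} (S : Finset X) (f : X → ZMod 2) (j : ZMod 2) :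
    koszulSign K (∑ s ∈ S, f s) j = ∏ s ∈ S, koszulSign K (f s) j := by
  classical
  induction S using Finset.induction_on with
  | empty => simp [koszulSign_zero_left]
  | insert a S ha ih => rw [Finset.sum_insert ha, Finset.prod_insert ha, koszulSign_add_left, ih]

end koszulSign

namespace LabelAlgebra

variable {K : Type*} [Field K] {Y Z : Type*}

/-- The parity of a generator. -/
def letterParity : Y ⊕ Z → ZMod 2 := Sum.elim (fun _ => 0) (fun _ => 1)

/-- The parity of a set of generators. -/
def setParity (S : Finset (Y ⊕ Z)) : ZMod 2 := ∑ s ∈ S, letterParity s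

variable [LinearOrder Z]

variable (K) in
/-- The sign `-1` if `(x, y)` is an inversion of odd generators, and `1` otherwise. -/
def letterSign : Y ⊕ Z → Y ⊕ Z → K
  | .inr a, .inr b => if b < a then -1 else 1
  | _, _ => 1

theorem letterSign_swap {x y : Y ⊕ Z} (h : x ≠ y) :
    letterSign K x y = koszulSign K (letterParity x) (letterParity y) * letterSign K y x := by
  rcases x with a | a <;> rcases y with b | b
  · simp [letterSign, letterParity, koszulSign]
  · simp [letterSign, letterParity, koszulSign]
  · simp [letterSign, letterParity, koszulSign]
  · have hab : a ≠ b := fun e => h (by rw [e])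
    have h1 : (1 : ZMod 2).val = 1 := rfl
    rcases lt_or_gt_of_ne hab with h | h <;>
      simp [letterSign, letterParity, koszulSign, h, h.not_gt, h1]

theorem letterSign_ne_zero (x y : Y ⊕ Z) : letterSign K x y ≠ 0 := by
  rcases x with a | a <;> rcases y with b | b <;> simp [letterSign]
  split_ifs <;> simp

variable (K) in
/-- The sign `(-1)^k`, where `k` is the number of odd inversions between `S` and `T`. -/
def setSign (S T : Finset (Y ⊕ Z)) : K := ∏ s ∈ S, ∏ t ∈ T, letterSign K s t

theorem setSign_ne_zero (S T : Finset (Y ⊕ Z)) : setSign K S T ≠ 0 :=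
  Finset.prod_ne_zero_iff.2 fun _ _ => Finset.prod_ne_zero_iff.2 fun _ _ => letterSign_ne_zero _ _

theorem setSign_swap {S T : Finset (Y ⊕ Z)} (h : Disjoint S T) :
    setSign K S T = koszulSign K (setParity S) (setParity T) * setSign K T S := by
  rw [setSign, setSign, Finset.prod_comm (s := T), setParity, koszulSign_sum_left,
    ← Finset.prod_mul_distrib]
  refine Finset.prod_congr rfl fun s hs => ?_
  rw [koszulSign_comm, setParity, koszulSign_sum_left, ← Finset.prod_mul_distrib]
  refine Finset.prod_congr rfl fun t ht => ?_
  rw [koszulSign_comm, letterSign_swap]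
  rintro rfl
  exact Finset.disjoint_left.1 h hs ht

variable [DecidableEq Y]

theorem setSign_union_left {S T : Finset (Y ⊕ Z)} (h : Disjoint S T) (U : Finset (Y ⊕ Z)) :
    setSign K (S ∪ T) U = setSign K S U * setSign K T U :=
  Finset.prod_union h

theorem setSign_union_right (S : Finset (Y ⊕ Z)) {T U : Finset (Y ⊕ Z)} (h : Disjoint T U) :
    setSign K S (T ∪ U) = setSign K S T * setSign K S U := by
  simp only [setSign, Finset.prod_union h, Finset.prod_mul_distrib]

/-- The product of the square-free part of the free supercommutative algebra: on basis elements,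
`e_S e_T = ± e_{S ∪ T}` if `S` and `T` are disjoint, and `e_S e_T = 0` otherwise. An element is
given by its (possibly infinitely many) coefficients. -/
def conv (f g : Finset (Y ⊕ Z) → K) (U : Finset (Y ⊕ Z)) : K :=
  ∑ S ∈ U.powerset, setSign K S (U \ S) * f S * g (U \ S)

/-- A function on sets of generators is homogeneous of parity `i` if it vanishes on the sets of
the other parity. -/
def IsHomogeneous (i : ZMod 2) (f : Finset (Y ⊕ Z) → K) : Prop := ∀ U, setParity U ≠ i → f U = 0

theorem setParity_sdiff_add {S U : Finset (Y ⊕ Z)} (h : S ⊆ U) :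
    setParity S + setParity (U \ S) = setParity U := by
  rw [add_comm]
  exact Finset.sum_sdiff h

theorem IsHomogeneous.conv {i j : ZMod 2} {f g : Finset (Y ⊕ Z) → K} (hf : IsHomogeneous i f)
    (hg : IsHomogeneous j g) : IsHomogeneous (i + j) (conv f g) := by
  intro U hU
  refine Finset.sum_eq_zero fun S hS => ?_
  by_cases h : setParity S = i
  · rw [hg (U \ S), mul_zero]
    intro h'
    exact hU (by rw [← setParity_sdiff_add (Finset.mem_powerset.1 hS), h, h'])
  · rw [hf S h, mul_zero, zero_mul]

theorem conv_left_comm {i j : ZMod 2} {f g : Finset (Y ⊕ Z) → K} (hf : IsHomogeneous i f)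
    (hg : IsHomogeneous j g) (h : Finset (Y ⊕ Z) → K) :
    conv f (conv g h) = koszulSign K i j • conv g (conv f h) := by
  funext U
  simp only [conv, Pi.smul_apply, smul_eq_mul, Finset.mul_sum]
  rw [Finset.sum_sigma', Finset.sum_sigma']
  -- Both sides sum over the decompositions of `U` into three parts; exchange the first two.
  refine Finset.sum_bij' (fun p _ => ⟨p.2, p.1⟩) (fun p _ => ⟨p.2, p.1⟩) ?_ ?_ ?_ ?_ ?_
  · rintro ⟨S, T⟩ hp
    simp only [Finset.mem_sigma, Finset.mem_powerset, Finset.subset_sdiff] at hp ⊢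
    exact ⟨hp.2.1, hp.1, hp.2.2.symm⟩
  · rintro ⟨S, T⟩ hp
    simp only [Finset.mem_sigma, Finset.mem_powerset, Finset.subset_sdiff] at hp ⊢
    exact ⟨hp.2.1, hp.1, hp.2.2.symm⟩
  · intros; rfl
  · intros; rfl
  · rintro ⟨S, T⟩ hp
    simp only [Finset.mem_sigma, Finset.mem_powerset, Finset.subset_sdiff] at hp ⊢
    obtain ⟨hS, hT, hST⟩ := hp
    by_cases h1 : setParity S = i
    swap
    · rw [hf S h1]; ring
    by_cases h2 : setParity T = j
    swap
    · rw [hg T h2]; ring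
    have e1 : U \ S = T ∪ (U \ S) \ T := by
      rw [Finset.union_sdiff_of_subset]; exact Finset.subset_sdiff.2 ⟨hT, hST⟩
    have e2 : U \ T = S ∪ (U \ S) \ T := by
      rw [sdiff_right_comm, Finset.union_sdiff_of_subset]
      exact Finset.subset_sdiff.2 ⟨hS, hST.symm⟩
    have s1 : setSign K S (U \ S) = setSign K S T * setSign K S ((U \ S) \ T) := by
      rw [← setSign_union_right _ Finset.disjoint_sdiff, ← e1]
    have s2 : setSign K T (U \ T) = setSign K T S * setSign K T ((U \ S) \ T) := by
      rw [← setSign_union_right, ← e2]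
      exact (Finset.disjoint_sdiff).mono_right Finset.sdiff_subset
    rw [s1, s2, ← sdiff_right_comm U S T, setSign_swap hST.symm, h1, h2]
    ring

theorem conv_right_comm {j k : ZMod 2} (f : Finset (Y ⊕ Z) → K) {g h : Finset (Y ⊕ Z) → K}
    (hg : IsHomogeneous j g) (hh : IsHomogeneous k h) :
    conv (conv f g) h = koszulSign K j k • conv (conv f h) g := by
  funext U
  simp only [conv, Pi.smul_apply, smul_eq_mul, Finset.mul_sum, Finset.sum_mul]
  rw [Finset.sum_sigma', Finset.sum_sigma']
  have hmem : ∀ R S : Finset (Y ⊕ Z), R ⊆ U ∧ S ⊆ R → S ∪ U \ R ⊆ U ∧ S ⊆ S ∪ U \ R :=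
    fun R S h => ⟨Finset.union_subset (h.2.trans h.1) Finset.sdiff_subset,
      Finset.subset_union_left⟩
  have hsd : ∀ R S : Finset (Y ⊕ Z), R ⊆ U ∧ S ⊆ R → U \ (S ∪ U \ R) = R \ S := by
    rintro R S ⟨hR, hS⟩
    ext x
    have := @hR x
    simp only [Finset.mem_sdiff, Finset.mem_union]
    tauto
  have hinv : ∀ R S : Finset (Y ⊕ Z), R ⊆ U ∧ S ⊆ R → S ∪ U \ (S ∪ U \ R) = R := by
    rintro R S h
    rw [hsd R S h, Finset.union_sdiff_of_subset h.2]
  -- Decompose `U` into `S`, `R \ S` and `U \ R`, and exchange the last two parts.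
  refine Finset.sum_bij' (fun p _ => ⟨p.2 ∪ U \ p.1, p.2⟩) (fun p _ => ⟨p.2 ∪ U \ p.1, p.2⟩)
    ?_ ?_ ?_ ?_ ?_
  · rintro ⟨R, S⟩ hp
    simp only [Finset.mem_sigma, Finset.mem_powerset] at hp ⊢
    exact hmem R S hp
  · rintro ⟨R, S⟩ hp
    simp only [Finset.mem_sigma, Finset.mem_powerset] at hp ⊢
    exact hmem R S hp
  · rintro ⟨R, S⟩ hp
    simp only [Finset.mem_sigma, Finset.mem_powerset] at hp
    simp only [hinv R S hp]
  · rintro ⟨R, S⟩ hp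
    simp only [Finset.mem_sigma, Finset.mem_powerset] at hp
    simp only [hinv R S hp]
  · rintro ⟨R, S⟩ hp
    simp only [Finset.mem_sigma, Finset.mem_powerset] at hp
    have e3 : (S ∪ U \ R) \ S = U \ R := by
      ext x
      have := @hp.2 x
      simp only [Finset.mem_sdiff, Finset.mem_union]
      tauto
    simp only [hsd R S hp, e3]
    by_cases h1 : setParity (R \ S) = j
    swap
    · rw [hg _ h1]; ring
    by_cases h2 : setParity (U \ R) = k
    swap
    · rw [hh _ h2]; ring
    have d1 : Disjoint S (U \ R) := Finset.disjoint_sdiff.mono_left hp.2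
    have d2 : Disjoint (R \ S) (U \ R) := Finset.disjoint_sdiff.mono_left Finset.sdiff_subset
    have s1 : setSign K R (U \ R) = setSign K S (U \ R) * setSign K (R \ S) (U \ R) := by
      rw [← setSign_union_left Finset.disjoint_sdiff, Finset.union_sdiff_of_subset hp.2]
    rw [s1, setSign_union_left d1, setSign_swap d2, h1, h2]
    ring

theorem conv_single {S T : Finset (Y ⊕ Z)} (h : Disjoint S T) (a b : K) :
    conv (Pi.single S a) (Pi.single T b) = Pi.single (S ∪ T) (setSign K S T * a * b) := by
  funext U
  rw [conv]
  by_cases hU : U = S ∪ T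
  · subst hU
    have e : (S ∪ T) \ S = T := by
      rw [Finset.union_sdiff_left, Finset.sdiff_eq_self_of_disjoint h.symm]
    rw [Finset.sum_eq_single S, e, Pi.single_eq_same, Pi.single_eq_same, Pi.single_eq_same]
    · intro R _ hR
      rw [Pi.single_eq_of_ne hR, mul_zero, zero_mul]
    · intro hS
      exact absurd (Finset.mem_powerset.2 Finset.subset_union_left) hS
  · rw [Pi.single_eq_of_ne hU]
    refine Finset.sum_eq_zero fun R hR => ?_
    by_cases h1 : R = S
    · subst h1
      rw [Pi.single_eq_of_ne (i := T), mul_zero]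
      rintro rfl
      exact hU (Finset.union_sdiff_of_subset (Finset.mem_powerset.1 hR)).symm
    · rw [Pi.single_eq_of_ne h1, mul_zero, zero_mul]

end LabelAlgebra

/-- Pairs of elements of the square-free supercommutative algebra with the product
`(a₁, a₂) (b₁, b₂) = (a₁ b₂, a₁ b₂)`. The components of a pair are its values as a left and as a
right factor. -/
def LabelAlgebra (K Y Z : Type*) : Type _ :=
  (Finset (Y ⊕ Z) → K) × (Finset (Y ⊕ Z) → K)

namespace LabelAlgebra

variable (K : Type*) [Field K] (Y Z : Type*)

instance : AddCommGroup (LabelAlgebra K Y Z) :=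
  inferInstanceAs (AddCommGroup ((Finset (Y ⊕ Z) → K) × (Finset (Y ⊕ Z) → K)))

instance : Module K (LabelAlgebra K Y Z) :=
  inferInstanceAs (Module K ((Finset (Y ⊕ Z) → K) × (Finset (Y ⊕ Z) → K)))

variable [DecidableEq Y] [LinearOrder Z]

instance : Mul (LabelAlgebra K Y Z) where
  mul a b := (conv a.1 b.2, conv a.1 b.2)

variable {K Y Z}

theorem mul_def (a b : LabelAlgebra K Y Z) : a * b = (conv a.1 b.2, conv a.1 b.2) := rfl

theorem conv_add (f g h : Finset (Y ⊕ Z) → K) : conv f (g + h) = conv f g + conv f h := by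
  funext U
  simp only [conv, Pi.add_apply, mul_add, Finset.sum_add_distrib]

theorem add_conv (f g h : Finset (Y ⊕ Z) → K) : conv (f + g) h = conv f h + conv g h := by
  funext U
  simp only [conv, Pi.add_apply, mul_add, add_mul, Finset.sum_add_distrib]

theorem conv_smul (r : K) (f g : Finset (Y ⊕ Z) → K) : conv f (r • g) = r • conv f g := by
  funext U
  simp only [conv, Pi.smul_apply, smul_eq_mul, Finset.mul_sum]
  exact Finset.sum_congr rfl fun _ _ => by ring

theorem smul_conv (r : K) (f g : Finset (Y ⊕ Z) → K) : conv (r • f) g = r • conv f g := by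
  funext U
  simp only [conv, Pi.smul_apply, smul_eq_mul, Finset.mul_sum]
  exact Finset.sum_congr rfl fun _ _ => by ring

theorem conv_zero (f : Finset (Y ⊕ Z) → K) : conv f 0 = 0 := by
  funext U
  simp [conv]

theorem zero_conv (f : Finset (Y ⊕ Z) → K) : conv 0 f = 0 := by
  funext U
  simp [conv]

instance : NonUnitalNonAssocRing (LabelAlgebra K Y Z) where
  left_distrib a b c := Prod.ext (conv_add a.1 b.2 c.2) (conv_add a.1 b.2 c.2)
  right_distrib a b c := Prod.ext (add_conv a.1 b.1 c.2) (add_conv a.1 b.1 c.2)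
  zero_mul a := Prod.ext (zero_conv a.2) (zero_conv a.2)
  mul_zero a := Prod.ext (conv_zero a.1) (conv_zero a.1)

instance : IsScalarTower K (LabelAlgebra K Y Z) (LabelAlgebra K Y Z) where
  smul_assoc r a b := Prod.ext (smul_conv r a.1 b.2) (smul_conv r a.1 b.2)

instance : SMulCommClass K (LabelAlgebra K Y Z) (LabelAlgebra K Y Z) where
  smul_comm r a b := Prod.ext (conv_smul r a.1 b.2).symm (conv_smul r a.1 b.2).symm

variable (K Y Z) in
/-- The pairs whose components are homogeneous of parity `i`. -/
def component (i : ZMod 2) : Submodule K (LabelAlgebra K Y Z) where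
  carrier := {a | IsHomogeneous i a.1 ∧ IsHomogeneous i a.2}
  zero_mem' := ⟨fun _ _ => rfl, fun _ _ => rfl⟩
  add_mem' := by
    rintro a b ⟨ha, ha'⟩ ⟨hb, hb'⟩
    refine ⟨fun U hU => ?_, fun U hU => ?_⟩
    · change a.1 U + b.1 U = 0
      rw [ha U hU, hb U hU, add_zero]
    · change a.2 U + b.2 U = 0
      rw [ha' U hU, hb' U hU, add_zero]
  smul_mem' := by
    rintro r a ⟨ha, ha'⟩
    refine ⟨fun U hU => ?_, fun U hU => ?_⟩
    · change r * a.1 U = 0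
      rw [ha U hU, mul_zero]
    · change r * a.2 U = 0
      rw [ha' U hU, mul_zero]

variable (K Y Z) in
theorem isBicommutativeSuperalgebra : IsBicommutativeSuperalgebra K (component K Y Z) where
  isInternal := by
    rw [DirectSum.isInternal_submodule_iff_isCompl (component K Y Z) (i := 0) (j := 1)
      (by decide) (by ext t; revert t; decide)]
    constructor
    · rw [Submodule.disjoint_def]
      rintro a ⟨h0, h0'⟩ ⟨h1, h1'⟩
      have key : ∀ f : Finset (Y ⊕ Z) → K, IsHomogeneous 0 f → IsHomogeneous 1 f → f = 0 := by
        intro f hf hf'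
        funext U
        by_cases hU : setParity U = 0
        · exact hf' U (by rw [hU]; decide)
        · exact hf U hU
      exact Prod.ext (key _ h0 h1) (key _ h0' h1')
    · rw [codisjoint_iff, eq_top_iff]
      rintro a -
      let b : LabelAlgebra K Y Z := (fun U => if setParity U = 0 then a.1 U else 0,
        fun U => if setParity U = 0 then a.2 U else 0)
      let c : LabelAlgebra K Y Z := (fun U => if setParity U = 0 then 0 else a.1 U,
        fun U => if setParity U = 0 then 0 else a.2 U)
      have hb : b ∈ component K Y Z 0 := ⟨fun U hU => if_neg hU, fun U hU => if_neg hU⟩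
      have h2 : ∀ t : ZMod 2, t ≠ 1 → t = 0 := by decide
      have hc : c ∈ component K Y Z 1 :=
        ⟨fun U hU => if_pos (h2 _ hU), fun U hU => if_pos (h2 _ hU)⟩
      have habc : a = b + c := by
        refine Prod.ext (funext fun U => ?_) (funext fun U => ?_)
        · change a.1 U = (if setParity U = 0 then a.1 U else 0) +
            (if setParity U = 0 then 0 else a.1 U)
          split_ifs <;> simp
        · change a.2 U = (if setParity U = 0 then a.2 U else 0) +
            (if setParity U = 0 then 0 else a.2 U)
          split_ifs <;> simp
      rw [habc]
      exact Submodule.add_mem_sup hb hc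
  mul_mem i j a ha b hb := ⟨ha.1.conv hb.2, ha.1.conv hb.2⟩
  left_comm i j k a ha b hb c _ :=
    Prod.ext (conv_left_comm ha.1 hb.1 c.2) (conv_left_comm ha.1 hb.1 c.2)
  right_comm i j k a _ b hb c hc :=
    Prod.ext (conv_right_comm a.1 hb.2 hc.2) (conv_right_comm a.1 hb.2 hc.2)

end LabelAlgebra

/-! ### Spanning -/

namespace FreeBicommSuper

open FreeBicomm FreeMagma

section spanning

variable (K : Type*) [Field K] {Y Z : Type*}

theorem monomial_mul (u v : FreeMagma (Y ⊕ Z)) :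
    monomial K (u * v) = monomial K u * monomial K v := map_mul _ _ _

theorem monomial_mem_component (w : FreeMagma (Y ⊕ Z)) :
    monomial K w ∈ component K Y Z (parity w) := by
  induction w using FreeMagma.recOnMul with
  | ih1 x => exact ⟨_, single_mem_freeComponent (FreeMagma.of x) 1, rfl⟩
  | ih2 u v hu hv =>
    rw [monomial_mul]
    exact (isBicommutativeSuperalgebra K Y Z).mul_mem _ _ _ hu _ hv

variable (Y Z) in
/-- The congruence that identifies monomials with the same value up to sign in the free
bicommutative superalgebra. -/
def signCon : Con (FreeMagma (Y ⊕ Z)) where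
  r u v := monomial K u = monomial K v ∨ monomial K u = -monomial K v
  iseqv :=
    { refl := fun _ => .inl rfl
      symm := by
        rintro u v (h | h)
        · exact .inl h.symm
        · exact .inr (by rw [h, neg_neg])
      trans := by
        rintro u v w (h | h) (h' | h') <;> rw [h, h'] <;> simp }
  mul' := by
    rintro u u' v v' (h | h) (h' | h') <;> rw [monomial_mul, monomial_mul, h, h'] <;> simp

theorem signCon_of_eq_smul {u v : FreeMagma (Y ⊕ Z)} {k : ℕ}
    (h : monomial K u = (-1 : K) ^ k • monomial K v) : signCon K Y Z u v := by
  rcases neg_one_pow_eq_or K k with e | e <;> rw [e] at h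
  · exact .inl (by rw [h, one_smul])
  · exact .inr (by rw [h, neg_smul, one_smul])

instance : IsBicommutativeMagma (signCon K Y Z).Quotient where
  left_comm a b c := by
    induction a using Con.induction_on with | _ a
    induction b using Con.induction_on with | _ b
    induction c using Con.induction_on with | _ c
    refine (Con.eq _).2 (signCon_of_eq_smul K (k := (parity a).val * (parity b).val) ?_)
    simp only [monomial_mul]
    exact (isBicommutativeSuperalgebra K Y Z).left_comm _ _ _ _ (monomial_mem_component K a) _
      (monomial_mem_component K b) _ (monomial_mem_component K c)
  right_comm a b c := by
    induction a using Con.induction_on with | _ a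
    induction b using Con.induction_on with | _ b
    induction c using Con.induction_on with | _ c
    refine (Con.eq _).2 (signCon_of_eq_smul K (k := (parity b).val * (parity c).val) ?_)
    simp only [monomial_mul]
    exact (isBicommutativeSuperalgebra K Y Z).right_comm _ _ _ _ (monomial_mem_component K a) _
      (monomial_mem_component K b) _ (monomial_mem_component K c)

/-- The class of a monomial in the free bicommutative superalgebra is determined up to sign by its
leaf labels. -/
theorem monomial_eq_or_neg {u v : FreeMagma (Y ⊕ Z)}
    (h : leafLabels true u = leafLabels true v) :
    monomial K u = monomial K v ∨ monomial K u = -monomial K v := by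
  have key : ∀ w : FreeMagma (Y ⊕ Z),
      FreeMagma.lift (fun x => ((FreeMagma.of x : FreeMagma (Y ⊕ Z)) :
        (signCon K Y Z).Quotient)) w = w := by
    intro w
    induction w using FreeMagma.recOnMul with
    | ih1 x => rfl
    | ih2 u v hu hv => rw [map_mul, hu, hv, Con.coe_mul]
  have h' := IsBicommutativeMagma.lift_eq_of_leafLabels_eq
    (fun x => ((FreeMagma.of x : FreeMagma (Y ⊕ Z)) : (signCon K Y Z).Quotient)) h
  rw [key, key] at h'
  exact (Con.eq _).1 h'

end spanning

/-! ### Sets of left leaves of multilinear monomials -/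

section leftSets

variable {X : Type*}

theorem map_fst_leafLabels (b : Bool) (w : FreeMagma X) :
    (leafLabels b w).map Prod.fst = letters w := by
  induction w using FreeMagma.recOnMul generalizing b with
  | ih1 x => rfl
  | ih2 u v hu hv =>
    rw [leafLabels_mul, Multiset.map_add, hu, hv]
    rfl

variable [DecidableEq X]

/-- The sets of left leaves of the monomials in which every element of `U` occurs exactly once: a
single letter counts as a left leaf, and a product has both left and right leaves. -/
def leftSets (U : Finset X) : Finset (Finset X) :=
  if U.card = 1 then {U} else U.powerset.filter fun S => S ≠ ∅ ∧ S ≠ U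

theorem subset_of_mem_leftSets {U S : Finset X} (h : S ∈ leftSets U) : S ⊆ U := by
  rw [leftSets] at h
  split_ifs at h
  · rw [Finset.mem_singleton.1 h]
  · exact Finset.mem_powerset.1 (Finset.mem_filter.1 h).1

theorem card_leftSets_of_card_eq_one {U : Finset X} (h : U.card = 1) :
    (leftSets U).card = 1 := by
  rw [leftSets, if_pos h, Finset.card_singleton]

theorem card_leftSets_of_one_lt {U : Finset X} (h : 1 < U.card) :
    (leftSets U).card = 2 ^ U.card - 2 := by
  have e : (U.powerset.filter fun S => S ≠ ∅ ∧ S ≠ U) = U.powerset \ {∅, U} := by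
    ext S
    simp
  have hU : ∅ ≠ U := by
    rintro rfl
    simp at h
  rw [leftSets, if_neg h.ne', e, Finset.card_sdiff_of_subset, Finset.card_powerset,
    Finset.card_pair hU]
  intro S hS
  rcases Finset.mem_insert.1 hS with rfl | hS
  · exact Finset.empty_mem_powerset _
  · rw [Finset.mem_singleton.1 hS]
    exact Finset.mem_powerset_self _

/-- The letters of `U`, those of `S` labelled as left and the others as right leaves. -/
def labelling (U S : Finset X) : Multiset (X × Bool) := U.val.map fun x => (x, decide (x ∈ S))

theorem map_fst_labelling (U S : Finset X) : (labelling U S).map Prod.fst = U.val := by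
  rw [labelling, Multiset.map_map]
  exact Multiset.map_id _

theorem exists_leafLabels_eq_labelling {U S : Finset X} (hU : U.Nonempty)
    (hS : S ∈ leftSets U) : ∃ w : FreeMagma X, leafLabels true w = labelling U S := by
  have hSU := subset_of_mem_leftSets hS
  rw [leftSets] at hS
  split_ifs at hS with h
  · obtain ⟨x, rfl⟩ := Finset.card_eq_one.1 h
    rw [Finset.mem_singleton] at hS
    subst hS
    exact ⟨FreeMagma.of x, by simp [labelling]⟩
  · obtain ⟨-, h0, h1⟩ := Finset.mem_filter.1 hS
    obtain ⟨x, hx⟩ := Finset.nonempty_iff_ne_empty.2 h0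
    obtain ⟨y, hyU, hyS⟩ := Finset.exists_of_ssubset (hSU.ssubset_of_ne h1)
    have hx' : (x, true) ∈ labelling U S := Multiset.mem_map.2 ⟨x, hSU hx, by simp [hx]⟩
    have hy' : (y, false) ∈ labelling U S := Multiset.mem_map.2 ⟨y, hyU, by simp [hyS]⟩
    obtain ⟨m, hm⟩ := Multiset.exists_cons_of_mem hx'
    rw [hm, Multiset.mem_cons] at hy'
    obtain ⟨m', rfl⟩ := Multiset.exists_cons_of_mem (hy'.resolve_left (by simp))
    obtain ⟨u, v, huv⟩ := exists_leafLabels_eq x y m'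
    exact ⟨u * v, huv.trans hm.symm⟩

theorem exists_labelling_eq_leafLabels {U : Finset X} {w : FreeMagma X}
    (h : letters w = U.val) : ∃ S ∈ leftSets U, leafLabels true w = labelling U S := by
  have hfst : (leafLabels true w).map Prod.fst = U.val := (map_fst_leafLabels true w).trans h
  have hmem : ∀ p ∈ leafLabels true w, p.1 ∈ U := fun p hp => by
    rw [← Finset.mem_val, ← hfst]
    exact Multiset.mem_map_of_mem _ hp
  let S := U.filter fun x => (x, true) ∈ leafLabels true w
  have hS : ∀ p ∈ leafLabels true w, p.2 = decide (p.1 ∈ S) := by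
    rintro ⟨x, b⟩ hp
    have hinj := Multiset.inj_on_of_nodup_map (hfst ▸ U.nodup)
    cases b
    · have : (x, true) ∉ leafLabels true w := fun h => by
        have := hinj _ hp _ h rfl
        simp at this
      simp [S, this]
    · simp [S, hp, hmem _ hp]
  refine ⟨S, ?_, ?_⟩
  · induction w using FreeMagma.recOnMul with
    | ih1 x =>
      have hU : U = {x} := Finset.val_injective h.symm
      subst hU
      rw [leftSets, if_pos (Finset.card_singleton x), Finset.mem_singleton]
      simp [S]
    | ih2 u v =>
      have hcard : U.card ≠ 1 := by
        rw [Finset.card_def, ← hfst, Multiset.card_map, leafLabels_mul, Multiset.card_add]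
        have := u.card_leafLabels_pos true
        have := v.card_leafLabels_pos false
        omega
      obtain ⟨x, hx⟩ := u.exists_mem_leafLabels true
      obtain ⟨y, hy⟩ := v.exists_mem_leafLabels false
      have hx' : (x, true) ∈ leafLabels true (u * v) := Multiset.mem_add.2 (.inl hx)
      have hy' : (y, false) ∈ leafLabels true (u * v) := Multiset.mem_add.2 (.inr hy)
      have hxS : x ∈ S := by simpa using hS _ hx'
      have hyS : y ∉ S := by simpa using hS _ hy'
      rw [leftSets, if_neg hcard, Finset.mem_filter, Finset.mem_powerset]
      exact ⟨Finset.filter_subset _ _, Finset.ne_empty_of_mem hxS,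
        fun e => hyS (e ▸ hmem _ hy')⟩
  · rw [labelling, ← hfst, Multiset.map_map]
    conv_lhs => rw [← Multiset.map_id (leafLabels true w)]
    exact Multiset.map_congr rfl fun p hp => Prod.ext rfl (hS p hp)

end leftSets

/-! ### Linear independence -/

section independence

variable (K : Type*) [Field K] {Y Z : Type*} [DecidableEq Y] [LinearOrder Z]

/-- The image of a generator in the model superalgebra: it vanishes as a right factor if it lies
in `S`, and as a left factor otherwise. -/
def modelLetter (S : Finset (Y ⊕ Z)) (x : Y ⊕ Z) : LabelAlgebra K Y Z :=
  (Pi.single {x} (if x ∈ S then 1 else 0), Pi.single {x} (if x ∈ S then 0 else 1))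

theorem modelLetter_mem (S : Finset (Y ⊕ Z)) (x : Y ⊕ Z) :
    modelLetter K S x ∈ LabelAlgebra.component K Y Z (LabelAlgebra.letterParity x) := by
  have h : ∀ c : K, LabelAlgebra.IsHomogeneous (LabelAlgebra.letterParity x)
      (Pi.single {x} c : Finset (Y ⊕ Z) → K) := by
    intro c U hU
    refine Pi.single_eq_of_ne ?_ _
    rintro rfl
    exact hU (Finset.sum_singleton _ _)
  exact ⟨h _, h _⟩

/-- The homomorphism to the model superalgebra that extends `modelLetter`. It detects the
multilinear monomials whose set of left leaves is `S`. -/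
noncomputable def toModel (S : Finset (Y ⊕ Z)) :
    FreeBicommSuper K Y Z →ₙₐ[K] LabelAlgebra K Y Z :=
  (existsUnique_lift (LabelAlgebra.isBicommutativeSuperalgebra K Y Z) (modelLetter K S)
    (fun y => modelLetter_mem K S (.inl y)) fun z => modelLetter_mem K S (.inr z)).1.choose

theorem toModel_of (S : Finset (Y ⊕ Z)) (x : Y ⊕ Z) : toModel K S (of K x) = modelLetter K S x :=
  (existsUnique_lift (LabelAlgebra.isBicommutativeSuperalgebra K Y Z) (modelLetter K S)
    (fun y => modelLetter_mem K S (.inl y))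
    fun z => modelLetter_mem K S (.inr z)).1.choose_spec.1 x

/-- A monomial in which every element of `U` occurs exactly once is mapped to a nonzero multiple of
`e_U` if its left leaves are the letters in `S`, and to `0` otherwise. -/
theorem exists_toModel_monomial (S : Finset (Y ⊕ Z)) (w : FreeMagma (Y ⊕ Z)) (b : Bool)
    {U : Finset (Y ⊕ Z)} (h : letters w = U.val) : ∃ c : K, c ≠ 0 ∧
      (if b then (toModel K S (monomial K w)).1 else (toModel K S (monomial K w)).2) =
        if ∀ p ∈ leafLabels b w, p.2 = decide (p.1 ∈ S) then Pi.single U c else 0 := by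
  induction w using FreeMagma.recOnMul generalizing b U with
  | ih1 x =>
    have hU : U = {x} := Finset.val_injective h.symm
    subst hU
    refine ⟨1, one_ne_zero, ?_⟩
    change (if b then (toModel K S (of K x)).1 else (toModel K S (of K x)).2) = _
    rw [toModel_of]
    by_cases hx : x ∈ S <;> cases b <;> simp [modelLetter, hx]
  | ih2 u v hu hv =>
    have h' : letters u + letters v = U.val := h
    have hnd : (letters u + letters v).Nodup := h' ▸ U.nodup
    obtain ⟨hu', hv', hd⟩ := Multiset.nodup_add.1 hnd
    obtain ⟨c, hc, ec⟩ := hu true (U := ⟨letters u, hu'⟩) rfl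
    obtain ⟨d, hd', ed⟩ := hv false (U := ⟨letters v, hv'⟩) rfl
    have hdisj : Disjoint (⟨letters u, hu'⟩ : Finset (Y ⊕ Z)) ⟨letters v, hv'⟩ :=
      Finset.disjoint_val.1 hd
    have hU : U = (⟨letters u, hu'⟩ : Finset (Y ⊕ Z)) ∪ ⟨letters v, hv'⟩ := by
      rw [← Finset.disjUnion_eq_union _ _ hdisj]
      exact Finset.val_injective h'.symm
    refine ⟨LabelAlgebra.setSign K ⟨letters u, hu'⟩ ⟨letters v, hv'⟩ * c * d,
      mul_ne_zero (mul_ne_zero (LabelAlgebra.setSign_ne_zero _ _) hc) hd', ?_⟩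
    rw [monomial_mul, map_mul, LabelAlgebra.mul_def]
    rw [if_pos rfl] at ec
    rw [if_neg (by decide)] at ed
    simp only [ite_self, leafLabels_mul]
    rw [ec, ed]
    simp only [Multiset.mem_add, or_imp, forall_and]
    split_ifs with h1 h2 h3 h4 h5
    · rw [LabelAlgebra.conv_single hdisj, hU]
    · exact absurd ⟨h1, h2⟩ h3
    · exact absurd h4.2 h2
    · exact LabelAlgebra.conv_zero _
    all_goals first | exact LabelAlgebra.zero_conv _ | (exfalso; tauto)

theorem letters_of_leafLabels {X : Type*} [DecidableEq X] {w : FreeMagma X} {U S : Finset X}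
    (h : leafLabels true w = labelling U S) : letters w = U.val := by
  rw [← map_fst_leafLabels true w, h, map_fst_labelling]

theorem toModel_monomial_self {w : FreeMagma (Y ⊕ Z)} {U S : Finset (Y ⊕ Z)}
    (h : leafLabels true w = labelling U S) : (toModel K S (monomial K w)).1 U ≠ 0 := by
  obtain ⟨c, hc, e⟩ := exists_toModel_monomial K S w true (letters_of_leafLabels h)
  rw [if_pos rfl, if_pos] at e
  · rw [e, Pi.single_eq_same]
    exact hc
  · intro p hp
    rw [h, labelling] at hp
    obtain ⟨x, -, rfl⟩ := Multiset.mem_map.1 hp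
    rfl

theorem toModel_monomial_of_ne {w : FreeMagma (Y ⊕ Z)} {U S U' S' : Finset (Y ⊕ Z)}
    (h : leafLabels true w = labelling U S) (hS : S ⊆ U) (hS' : S' ⊆ U')
    (hne : ¬(U = U' ∧ S = S')) : (toModel K S' (monomial K w)).1 U' = 0 := by
  obtain ⟨c, hc, e⟩ := exists_toModel_monomial K S' w true (letters_of_leafLabels h)
  rw [if_pos rfl] at e
  rw [e]
  split_ifs with hp
  · refine Pi.single_eq_of_ne ?_ _
    rintro rfl
    refine hne ⟨rfl, ?_⟩
    have key : ∀ x ∈ U', x ∈ S ↔ x ∈ S' := by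
      intro x hx
      have := hp (x, decide (x ∈ S)) (by rw [h, labelling]; exact Multiset.mem_map.2 ⟨x, hx, rfl⟩)
      simpa using this
    ext x
    exact ⟨fun hx => (key x (hS hx)).1 hx, fun hx => (key x (hS' hx)).2 hx⟩
  · rfl

/-- The dimension of the span of the monomials in which, for some `U` in the family `𝒰`, every
element of `U` occurs exactly once and no other letter occurs. -/
theorem rank_span_monomial (𝒰 : Finset (Finset (Y ⊕ Z))) (h𝒰 : ∀ U ∈ 𝒰, U.Nonempty) :
    Module.rank K (Submodule.span K {f : FreeBicommSuper K Y Z | ∃ w : FreeMagma (Y ⊕ Z),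
      (∃ U ∈ 𝒰, letters w = U.val) ∧ f = monomial K w}) =
    ((∑ U ∈ 𝒰, (leftSets U).card : ℕ) : Cardinal) := by
  have hex : ∀ i : 𝒰.sigma leftSets, ∃ w : FreeMagma (Y ⊕ Z),
      leafLabels true w = labelling i.1.1 i.1.2 := fun i =>
    exists_leafLabels_eq_labelling (h𝒰 _ (Finset.mem_sigma.1 i.2).1) (Finset.mem_sigma.1 i.2).2
  choose w hw using hex
  have hsub : ∀ i : 𝒰.sigma leftSets, i.1.2 ⊆ i.1.1 := fun i =>
    subset_of_mem_leftSets (Finset.mem_sigma.1 i.2).2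
  have hli : LinearIndependent K fun i => monomial K (w i) := by
    rw [Fintype.linearIndependent_iff]
    intro g hg i
    -- Only the `i`-th summand survives in the coefficient of `toModel` that belongs to `i`.
    let φ : FreeBicommSuper K Y Z →ₗ[K] K :=
      (LinearMap.proj i.1.1).comp ((LinearMap.fst K (Finset (Y ⊕ Z) → K) (Finset (Y ⊕ Z) → K)).comp
        (toModel K i.1.2 : FreeBicommSuper K Y Z →ₗ[K] LabelAlgebra K Y Z))
    have hφ : ∀ x, φ x = (toModel K i.1.2 x).1 i.1.1 := fun x => rfl
    have h0 := congrArg φ hg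
    rw [map_sum, map_zero, Finset.sum_eq_single i] at h0
    · rw [map_smul, hφ, smul_eq_mul] at h0
      exact (mul_eq_zero.1 h0).resolve_right (toModel_monomial_self K (hw i))
    · intro j _ hj
      rw [map_smul, hφ, toModel_monomial_of_ne K (hw j) (hsub j) (hsub i), smul_zero]
      rintro ⟨h1, h2⟩
      exact hj (Subtype.ext (Sigma.ext h1 (heq_of_eq h2)))
    · intro h
      exact absurd (Finset.mem_univ i) h
  have hspan : Submodule.span K {f : FreeBicommSuper K Y Z | ∃ w : FreeMagma (Y ⊕ Z),
      (∃ U ∈ 𝒰, letters w = U.val) ∧ f = monomial K w} =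
      Submodule.span K (Set.range fun i => monomial K (w i)) := by
    apply le_antisymm <;> rw [Submodule.span_le]
    · rintro _ ⟨v, ⟨U, hU, hv⟩, rfl⟩
      obtain ⟨S, hS, hl⟩ := exists_labelling_eq_leafLabels hv
      have hmem := Submodule.subset_span (R := K) (Set.mem_range_self (f := fun i =>
        monomial K (w i)) ⟨⟨U, S⟩, Finset.mem_sigma.2 ⟨hU, hS⟩⟩)
      rcases monomial_eq_or_neg K (hl.trans (hw ⟨⟨U, S⟩, Finset.mem_sigma.2 ⟨hU, hS⟩⟩).symm)
        with e | e
      · rw [e]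
        exact hmem
      · rw [e]
        exact neg_mem hmem
    · rintro _ ⟨i, rfl⟩
      exact Submodule.subset_span ⟨w i, ⟨i.1.1, (Finset.mem_sigma.1 i.2).1,
        letters_of_leafLabels (hw i)⟩, rfl⟩
  rw [hspan]
  have hfin : Module.Finite K (Submodule.span K (Set.range fun i => monomial K (w i))) :=
    FiniteDimensional.span_of_finite K (Set.finite_range _)
  rw [← Module.finrank_eq_rank, finrank_span_eq_card hli, Fintype.card_coe, Finset.card_sigma]

end independence

/-! ### Counting -/

section counting

variable (K : Type*) [Field K]

/-- The variables `y₀, …, y_{p-1}, z₀, …, z_{q-1}`. -/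
def rangeLetters (p q : ℕ) : Finset (ℕ ⊕ ℕ) := (Finset.range p).disjSum (Finset.range q)

theorem superCodim_eq {p q : ℕ} (h : 0 < p + q) :
    superCodim K p q = ((leftSets (rangeLetters p q)).card : Cardinal) := by
  have hU : (rangeLetters p q).val =
      (Multiset.range p).map Sum.inl + (Multiset.range q).map Sum.inr := rfl
  have := rank_span_monomial K {rangeLetters p q} (by
    intro U hU
    rw [Finset.mem_singleton.1 hU, ← Finset.card_pos, rangeLetters, Finset.card_disjSum,
      Finset.card_range, Finset.card_range]
    exact h)
  rw [Finset.sum_singleton] at this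
  rw [← this]
  refine congrArg (fun s => Module.rank K (Submodule.span K s)) (Set.ext fun f => ?_)
  simp only [Set.mem_ofPred_eq, Finset.mem_singleton, exists_eq_left, hU]

/-- The sets of letters that contain exactly one of `y_i`, `z_i` for each `i < n`, and no other
letter: such a set is given by the indices of its odd letters. -/
def transversals (n : ℕ) : Finset (Finset (ℕ ⊕ ℕ)) :=
  (Finset.range n).powerset.image fun T => (Finset.range n \ T).disjSum T

theorem card_transversals (n : ℕ) : (transversals n).card = 2 ^ n := by
  rw [transversals, Finset.card_image_of_injective, Finset.card_powerset, Finset.card_range]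
  intro T T' h
  ext x
  have := congrArg (fun U => Sum.inr x ∈ U) h
  simpa using this

theorem card_of_mem_transversals {n : ℕ} {U : Finset (ℕ ⊕ ℕ)} (h : U ∈ transversals n) :
    U.card = n := by
  obtain ⟨T, hT, rfl⟩ := Finset.mem_image.1 h
  rw [Finset.card_disjSum, Finset.card_sdiff_add_card_eq_card (Finset.mem_powerset.1 hT),
    Finset.card_range]

theorem map_elim_val_eq_range_iff {n : ℕ} {m : Multiset (ℕ ⊕ ℕ)} :
    m.map (Sum.elim id id) = Multiset.range n ↔ ∃ U ∈ transversals n, m = U.val := by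
  constructor
  · intro h
    have hnd : (m.map (Sum.elim id id)).Nodup := h ▸ Multiset.nodup_range n
    have hinj := Multiset.inj_on_of_nodup_map hnd
    have hmem : ∀ i, i < n ↔ Sum.inl i ∈ m ∨ Sum.inr i ∈ m := by
      intro i
      rw [← Multiset.mem_range, ← h, Multiset.mem_map]
      simp
    refine ⟨⟨m, hnd.of_map _⟩, Finset.mem_image.2
      ⟨(Finset.range n).filter fun i => Sum.inr i ∈ m,
        Finset.mem_powerset.2 (Finset.filter_subset _ _), ?_⟩, rfl⟩
    ext x
    rcases x with i | i
    · have h1 : Sum.inl i ∈ m → Sum.inr i ∉ m := fun h1 h2 => by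
        have := hinj _ h1 _ h2 rfl
        cases this
      have := hmem i
      simp only [Finset.inl_mem_disjSum, Finset.mem_sdiff, Finset.mem_filter, Finset.mem_range,
        Finset.mem_mk]
      tauto
    · have := hmem i
      simp only [Finset.inr_mem_disjSum, Finset.mem_filter, Finset.mem_range, Finset.mem_mk]
      tauto
  · rintro ⟨U, hU, rfl⟩
    obtain ⟨T, hT, rfl⟩ := Finset.mem_image.1 hU
    have hd : Disjoint (Finset.range n \ T) T := Finset.sdiff_disjoint
    have h2 : (Finset.range n \ T).val + T.val = (Finset.range n).val := by
      rw [← Finset.disjUnion_val _ _ hd, Finset.disjUnion_eq_union,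
        Finset.sdiff_union_of_subset (Finset.mem_powerset.1 hT)]
    have h1 : ((Finset.range n \ T).disjSum T).val =
        (Finset.range n \ T).val.map Sum.inl + T.val.map Sum.inr := rfl
    rw [h1, Multiset.map_add, Multiset.map_map, Multiset.map_map]
    simpa using h2

theorem codim_eq {n : ℕ} (h : 0 < n) :
    codim K n = ((∑ U ∈ transversals n, (leftSets U).card : ℕ) : Cardinal) := by
  rw [← rank_span_monomial K (transversals n) fun U hU => by
    rw [← Finset.card_pos, card_of_mem_transversals hU]
    exact h]
  refine congrArg (fun s => Module.rank K (Submodule.span K s)) (Set.ext fun f => ?_)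
  simp only [Set.mem_ofPred_eq, map_elim_val_eq_range_iff]

end counting

end FreeBicommSuper

theorem corollary3p4 (K : Type*) [Field K] (hK : ringChar K ≠ 2) :
    (∀ p q : ℕ, 1 < p + q →
      FreeBicommSuper.superCodim K p q = ((2 ^ (p + q) - 2 : ℕ) : Cardinal)) ∧
    (∀ p q : ℕ, p + q = 1 → FreeBicommSuper.superCodim K p q = 1) ∧
    (∀ n : ℕ, 1 < n →
      FreeBicommSuper.codim K n = ((2 ^ (2 * n) - 2 ^ (n + 1) : ℕ) : Cardinal)) ∧
    FreeBicommSuper.codim K 1 = 2 := by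
  have hcard : ∀ p q, (FreeBicommSuper.rangeLetters p q).card = p + q := fun p q => by
    rw [FreeBicommSuper.rangeLetters, Finset.card_disjSum, Finset.card_range, Finset.card_range]
  refine ⟨fun p q h => ?_, fun p q h => ?_, fun n h => ?_, ?_⟩
  · rw [FreeBicommSuper.superCodim_eq K (by omega),
      FreeBicommSuper.card_leftSets_of_one_lt (by rw [hcard]; exact h), hcard]
  · rw [FreeBicommSuper.superCodim_eq K (by omega),
      FreeBicommSuper.card_leftSets_of_card_eq_one (by rw [hcard]; exact h), Nat.cast_one]
  · rw [FreeBicommSuper.codim_eq K (by omega), Finset.sum_congr rfl fun U hU => by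
      rw [FreeBicommSuper.card_leftSets_of_one_lt
        (by rw [FreeBicommSuper.card_of_mem_transversals hU]; exact h),
        FreeBicommSuper.card_of_mem_transversals hU], Finset.sum_const,
      FreeBicommSuper.card_transversals, smul_eq_mul, Nat.mul_sub, ← pow_add, ← two_mul, pow_succ]
  · rw [FreeBicommSuper.codim_eq K one_pos, Finset.sum_congr rfl fun U hU =>
      FreeBicommSuper.card_leftSets_of_card_eq_one (FreeBicommSuper.card_of_mem_transversals hU),
      Finset.sum_const, FreeBicommSuper.card_transversals]
    norm_num
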